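/- **Setting.** A game graph $G$ consists of a finite directed graph $(S,E)$ in which every state $s$ has a non-empty set $E(s)$ of successors, and of a partition $(S_1,S_2)$ of $S$ into the states of player 1 and of player 2. Put $n=|S|$, $m=|E|$, $\delta(G)=\max_s|E(s)|$ and $\mathrm{source}(U,G)=\{s\in S: E(s)\cap U\ne\emptyset\}$. For $X\subseteq S$ let $G{\restriction}X$ be the subgraph induced by $X$. For a graph $H$ on a subset of $S$, the attractor $\mathrm{Attr}_p(U,H)$ is the least set that contains $U$, each player-$p$ state with an $H$-edge into the set, and each state of the other player that has $H$-edges, all of which lead into the set. It is computed by backward search: repeatedly pick an edge of $H$ that enters the states found so far and has not been worked on yet, and work on it; this costs one unit per state of $U$ and one per edge worked on. For $B,X\subseteq S$ let $\mathrm{AvoidSetClassical}(X,B)=\mathrm{Attr}_2(X\setminus\mathrm{Attr}_1(B\cap X,G{\restriction}X),\,G{\restriction}X)$. Logarithms inside the algorithm are to a fixed base $\beta>1$. **Algorithm (improved algorithm for Büchi games).** Input: $G$ and $B\subseteq S$. Start with $S^0=S$, $W_0=\emptyset$, $i=0$ and repeat: 1. If $|\mathrm{source}(W_i,G)|\ge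 m/\log n$, let $W_{i+1}=\mathrm{AvoidSetClassical}(S^i,B)$. 2. Otherwise add to $G_i=G{\restriction}S^i$ an auxiliary state $\hat s$ with an edge to each state of $\mathrm{source}(W_i,G)\cap S^i$. Perform a breadth-first search from $\hat s$ for $\lfloor 2m/\log n\rfloor$ steps (fewer if no edge is left). Each step explores one edge that leaves a discovered state of least depth among the discovered states with unexplored edges. Let $R$ be the explored subgraph of $G_i$ (its states are the discovered states other than $\hat s$, its edges are the explored edges between them). Let $F$ be the set of states of $R$ with an unexplored edge, and let $T$ consist of the player-1 states in $F$ and the player-2 states in $F$ with no outgoing edge in $R$. Let $A=\mathrm{Attr}_1((R\cap B)\cup T,R)$ and $\mathrm{Tr}_i=R\setminus A$. If $\mathrm{Tr}_i\ne\emptyset$, let $W_{i+1}=\mathrm{Attr}_2(\mathrm{Tr}_i,G_i)$; otherwise let $W_{i+1}=\mathrm{AvoidSetClassical}(S^i,B)$. 3. Let $S^{i+1}=S^i\setminus W_{i+1}$ and increase $i$ by one. The loop ends when $W_i=\emptyset$; the output is $\bigcup_k W_k$. **Work.** The work is the number of unit operations on states and edges. Reading the input costs $n+m$. In an iteration, the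 size test of step 1 costs one unit plus one per edge of $G$ entering $W_i$. Adding the auxiliary edges costs one unit each. Each search step costs one unit. Each attractor computation costs its backward search. Forming the target set of $A$ and forming $\mathrm{Tr}_i=R\setminus A$ cost one unit per state of $R$ each. Forming $B\cap S^i$ and the complement in AvoidSetClassical cost $|S^i|$ each. Removing $W_{i+1}$ costs one unit per state of $W_{i+1}$ and one per edge of $G_i$ that enters or leaves $W_{i+1}$. **Theorem.** For every base $\beta>1$ there is a constant $C$, depending only on $\beta$, such that for every game graph $G$ with $n\ge 2$ states and every $B\subseteq S$, every execution of the algorithm (whatever order it chooses the edges in, within the rules above) terminates, never gets stuck, and has total work at most $$C\cdot n\cdot m\cdot\frac{\log\max(\delta(G),2)}{\log n}.$$ In particular, the total work is $O\big(n\,m\,\log\delta(G)/\log n\big)$ when $\delta(G)\ge 2$. -/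

import Mathlib

open Finset

/-- A game graph on the finite state set `V`: `succ s` is the set of successors of `s`, every state
has at least one, `player1` is the set of player 1 states and its complement is the set of
player 2 states. -/
structure GameGraph (V : Type*) [Fintype V] [DecidableEq V] where
  succ : V → Finset V
  succ_nonempty : ∀ s, (succ s).Nonempty
  player1 : Finset V

/-- `Steps r k x y`: some execution with exactly `k` steps of `r` leads from `x` to `y`. -/
inductive Steps {σ : Type*} (r : σ → σ → Prop) : ℕ → σ → σ → Prop
  | refl (x : σ) : Steps r 0 x x
  | tail {k : ℕ} {x y z : σ} : Steps r k x y → r y z → Steps r (k + 1) x z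

/-! ### Backward search (attractor computation) -/

/-- A configuration of the backward search: the states found so far, and the edges that have
already been worked on. -/
structure Search (V : Type*) where
  attr : Finset V
  done : Finset (V × V)

/-- One elementary step of the backward search, for the player who moves at the states in `P`, in
the directed graph with edge set `H`: take an edge `(u, v)` of `H` that enters the states found so
far and has not been worked on. The state `u` is found if it belongs to the player, or if each
edge of `H` leaving `u` has now been worked on (a counter, decremented once per step). -/
def Search.Step {V : Type*} [Fintype V] [DecidableEq V] (P : Finset V) (H : Finset (V × V))
    (c c' : Search V) : Prop :=
  ∃ u v, (u, v) ∈ H ∧ v ∈ c.attr ∧ (u, v) ∉ c.done ∧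
    c'.done = insert (u, v) c.done ∧
    c'.attr = if u ∈ P ∨ (∀ w, (u, w) ∈ H → (u, w) ∈ c'.done) then insert u c.attr else c.attr

/-- A complete backward search from the target set `U` ends with the attractor `A` of `U` and
performs work `work`: one unit per state of `U`, and one unit per edge worked on. -/
def AttrRun {V : Type*} [Fintype V] [DecidableEq V] (P : Finset V) (H : Finset (V × V))
    (U A : Finset V) (work : ℕ) : Prop :=
  ∃ (k : ℕ) (D : Finset (V × V)), Steps (Search.Step P H) k ⟨U, ∅⟩ ⟨A, D⟩ ∧
    (∀ c', ¬ Search.Step P H ⟨A, D⟩ c') ∧ work = #U + k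

/-! ### Breadth-first search -/

/-- A configuration of a breadth-first search: the discovered states, their depths, and the
explored edges. -/
structure BFS (α : Type*) where
  disc : Finset α
  depth : α → ℕ
  expl : Finset (α × α)

namespace BFS

variable {α : Type*} [DecidableEq α]

/-- The start of the search from `r`. -/
def init (r : α) : BFS α := ⟨{r}, fun _ => 0, ∅⟩

/-- The frontier: the discovered states that have an unexplored outgoing edge; `N` is the successor
function of the graph. -/
def frontier (N : α → Finset α) (b : BFS α) : Finset α :=
  b.disc.filter fun u => ∃ t ∈ N u, (u, t) ∉ b.expl

/-- One elementary step: explore an edge that leaves a frontier state of least depth. -/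
def Step (N : α → Finset α) (b b' : BFS α) : Prop :=
  ∃ u ∈ b.frontier N, (∀ u' ∈ b.frontier N, b.depth u ≤ b.depth u') ∧
    ∃ t ∈ N u, (u, t) ∉ b.expl ∧
      b' = if t ∈ b.disc then ⟨b.disc, b.depth, insert (u, t) b.expl⟩
        else ⟨insert t b.disc, Function.update b.depth t (b.depth u + 1), insert (u, t) b.expl⟩

/-- A breadth-first search from `r` that is stopped after `K` steps, or earlier if there is no
edge left to explore; `k` is the number of steps performed. -/
def Run (N : α → Finset α) (r : α) (K k : ℕ) (b : BFS α) : Prop :=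
  Steps (Step N) k (init r) b ∧ k ≤ K ∧ (k = K ∨ ∀ b', ¬ Step N b b')

end BFS

namespace GameGraph

variable {V : Type*} [Fintype V] [DecidableEq V]

/-- The number `m` of edges. -/
def numEdges (G : GameGraph V) : ℕ := ∑ s, #(G.succ s)

/-- The maximum out-degree `δ(G)`. -/
def maxOutdeg (G : GameGraph V) : ℕ := univ.sup fun s => #(G.succ s)

/-- `source(U, G)`: the states with an edge that enters `U`. -/
def source (G : GameGraph V) (U : Finset V) : Finset V :=
  univ.filter fun s => (G.succ s ∩ U).Nonempty

/-- The edges of the subgraph induced by the set `X` of states. -/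
def edges (G : GameGraph V) (X : Finset V) : Finset (V × V) :=
  univ.filter fun e => e.1 ∈ X ∧ e.2 ∈ X ∧ e.2 ∈ G.succ e.1

/-- The procedure `AvoidSetClassical` on the subgame with state set `X`, with result `W'`:
`R := Attr₁(B ∩ X)`, `Tr := X \ R`, `W' := Attr₂(Tr)`. Setting up the target set and forming the
complement cost one unit per state of `X` each. -/
def AvoidSetClassical (G : GameGraph V) (B X W' : Finset V) (work : ℕ) : Prop :=
  ∃ (R : Finset V) (c₁ c₂ : ℕ),
    AttrRun G.player1 (G.edges X) (B ∩ X) R c₁ ∧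
    AttrRun G.player1ᶜ (G.edges X) (X \ R) W' c₂ ∧
    work = #X + c₁ + #X + c₂

/-- The successor function of the subgame with state set `X`, extended by the auxiliary state
`none` with an edge to each state of `U`. -/
def auxSucc (G : GameGraph V) (X U : Finset V) : Option V → Finset (Option V)
  | none => U.image some
  | some v => (G.succ v ∩ X).image some

/-- The threshold `m / log n`; the logarithm has base `β`. -/
noncomputable def threshold (G : GameGraph V) (β : ℝ) : ℝ :=
  (G.numEdges : ℝ) / Real.logb β (Fintype.card V)

/-- The cheap forward exploration (steps 4.2.1 to 4.2.6 of the algorithm) in the subgame with state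
set `X`, where `W` is the set removed last, with result `Tr`.

Add an auxiliary state with an edge to each remaining state of `source(W, G)`; perform a
breadth-first search from it for `2 m / log n` steps. This finds a subgraph, with state set `R` and
edge set `H` (the explored edges), and the frontier `F`. Let `T` consist of the player 1 states of
`F` and the player 2 states of `F` without outgoing edge in the subgraph, compute the attractor
`A` for player 1 of `(R ∩ B) ∪ T` in the subgraph, and let `Tr := R \ A`.

One unit of work is charged for each auxiliary edge added, each step of the search, each state of
`R` when the target is formed, and again when `Tr` is formed; and the work for `A`. -/
def Forward (G : GameGraph V) (β : ℝ) (B X W Tr : Finset V) (work : ℕ) : Prop :=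
  ∃ (k : ℕ) (b : BFS (Option V)),
    BFS.Run (G.auxSucc X (G.source W ∩ X)) none ⌊2 * G.threshold β⌋₊ k b ∧
    ∃ R F T A : Finset V, ∃ H : Finset (V × V), ∃ c : ℕ,
      R = univ.filter (fun v => some v ∈ b.disc) ∧
      H = univ.filter (fun e => (some e.1, some e.2) ∈ b.expl) ∧
      F = univ.filter (fun v => some v ∈ b.frontier (G.auxSucc X (G.source W ∩ X))) ∧
      T = F.filter (fun s => s ∈ G.player1 ∨ ∀ t, (s, t) ∉ H) ∧
      AttrRun G.player1 H ((R ∩ B) ∪ T) A c ∧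
      Tr = R \ A ∧
      work = #(G.source W ∩ X) + k + #R + c + #R

/-- The work for computing `source(W, G)` and testing its size: one unit, and one per edge of `G`
that enters `W`. -/
def sourceWork (G : GameGraph V) (W : Finset V) : ℕ :=
  1 + #((G.edges univ).filter fun e => e.2 ∈ W)

/-- Steps 4.1 and 4.2 of one iteration, in the subgame with state set `X`; `W` is the set that the
previous iteration removed (empty at the start) and `W'` is the set that this one computes. -/
inductive Iteration (G : GameGraph V) (β : ℝ) (B X W : Finset V) : Finset V → ℕ → Prop
  | large {W' : Finset V} {c : ℕ} (h : G.threshold β ≤ (#(G.source W) : ℝ))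
      (hc : G.AvoidSetClassical B X W' c) :
      Iteration G β B X W W' (G.sourceWork W + c)
  | found {Tr W' : Finset V} {c c' : ℕ} (h : (#(G.source W) : ℝ) < G.threshold β)
      (hf : G.Forward β B X W Tr c) (hTr : Tr.Nonempty)
      (ha : AttrRun G.player1ᶜ (G.edges X) Tr W' c') :
      Iteration G β B X W W' (G.sourceWork W + c + c')
  | fallback {W' : Finset V} {c c' : ℕ} (h : (#(G.source W) : ℝ) < G.threshold β)
      (hf : G.Forward β B X W ∅ c) (hc : G.AvoidSetClassical B X W' c') :
      Iteration G β B X W W' (G.sourceWork W + c + c')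

/-- The state of the algorithm between two iterations: the index `i`, the set `Sⁱ` of remaining
states, the set `Wᵢ` removed last, the union of all removed sets, and the work done so far. -/
structure Config (V : Type*) where
  iter : ℕ
  states : Finset V
  last : Finset V
  out : Finset V
  work : ℕ

/-- Steps 1 to 3, with work for reading the input. -/
def start (G : GameGraph V) : Config V := ⟨0, univ, ∅, ∅, Fintype.card V + G.numEdges⟩

/-- The loop ends when an iteration has produced the empty set; the result is `out`. -/
def Config.Halted (c : Config V) : Prop := 0 < c.iter ∧ c.last = ∅

/-- One pass through the loop. Removing `W'` from the subgame (step 4.3) costs one unit per state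
of `W'` and one per edge of the subgame that enters or leaves `W'`. -/
def Pass (G : GameGraph V) (β : ℝ) (B : Finset V) (c c' : Config V) : Prop :=
  ¬ c.Halted ∧ ∃ (W' : Finset V) (w : ℕ), G.Iteration β B c.states c.last W' w ∧
    c' = ⟨c.iter + 1, c.states \ W', W', c.out ∪ W',
      c.work + w + #W' + #((G.edges c.states).filter fun e => e.1 ∈ W' ∨ e.2 ∈ W')⟩

/-- The configurations that the algorithm can reach on input `G`, `B`. -/
def Reachable (G : GameGraph V) (β : ℝ) (B : Finset V) (c : Config V) : Prop :=
  Relation.ReflTransGen (G.Pass β B) G.start c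

end GameGraph

/-! A classical call costs O(m), a forward exploration O(m / log n), and there are at most n + 1
iterations, since each but the last removes a state. So everything rests on how often
`AvoidSetClassical` runs.

Let Δ = max(δ(G), 2) and d = ⌊log n / (a log Δ)⌋ for a constant a. If source(W) is small, the
breadth-first search explores all edges that leave states of depth at most d. It then catches a part
of each trap with at most d states that meets source(W): the trap states discovered up to a suitable
depth j ≤ d already form a trap of the explored subgraph (`Forward.finds_trap`). A trap that misses
source(W) was a trap before W was removed. Hence, while sources stay small, every trap with at most
d states meets source(W) (`Clean`), and a classical call that removes anything removes more than d
states. There are O(n log Δ / log n) such calls.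

The search reaches far enough only if |source(W)| < τ = m / (√n + log n), which is below the
threshold that the algorithm itself tests (`exploration_suffices`). A larger source may destroy
cleanliness, but it is paid for by the edges into W. The removed sets are disjoint, so this costs
O(m (√n + log n)) altogether. `Good.pass` does the accounting: ρ per edge into a removed set, μ per
removed state, and a credit of 6m whenever the graph may be unclean, to be spent on the classical
call that makes it clean again. -/

/-! ### Executions and their lengths -/

section Steps

variable {σ : Type*} {r : σ → σ → Prop}

/-- A property that is preserved by each step is preserved by executions. -/
theorem Steps.invariant {p : σ → Prop} (hp : ∀ x y, r x y → p x → p y) {k : ℕ} {x y : σ}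
    (h : Steps r k x y) (hx : p x) : p y := by
  induction h with
  | refl => exact hx
  | tail _ hr ih => exact hp _ _ hr (ih hx)

/-- A quantity that grows by one in each step counts the steps. -/
theorem Steps.measure_eq {f : σ → ℕ} (hf : ∀ x y, r x y → f y = f x + 1) {k : ℕ} {x y : σ}
    (h : Steps r k x y) : f y = f x + k := by
  induction h with
  | refl => rfl
  | tail _ hr ih => rw [hf _ _ hr, ih]; rfl

/-- If no execution exceeds the length `N`, then some execution cannot be continued; it may also be
cut off after `K` steps. -/
theorem Steps.exists_stopped (x : σ) (K : ℕ) :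
    ∃ k y, Steps r k x y ∧ k ≤ K ∧ (k = K ∨ ∀ z, ¬ r y z) := by
  induction K with
  | zero => exact ⟨0, x, .refl x, le_rfl, .inl rfl⟩
  | succ K ih =>
    obtain ⟨k, y, hy, hk, h⟩ := ih
    by_cases hz : ∃ z, r y z
    · obtain ⟨z, hz⟩ := hz
      rcases h with rfl | h
      · exact ⟨k + 1, z, hy.tail hz, le_rfl, .inl rfl⟩
      · exact absurd hz (h z)
    · exact ⟨k, y, hy, hk.trans K.le_succ, .inr (not_exists.mp hz)⟩

end Steps

/-! ### Backward search computes attractors -/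

section Attractor

variable {V : Type*} [Fintype V] [DecidableEq V] {P : Finset V} {H : Finset (V × V)}

theorem Search.Step.attr_subset {c c' : Search V} (h : Search.Step P H c c') :
    c.attr ⊆ c'.attr := by
  obtain ⟨u, v, -, -, -, -, h⟩ := h
  rw [h]
  split_ifs
  · exact subset_insert _ _
  · exact Subset.rfl

/-- The edges worked on are edges of the graph that enter the states found. -/
theorem Search.done_invariant {k : ℕ} {U : Finset V} {c : Search V}
    (h : Steps (Search.Step P H) k ⟨U, ∅⟩ c) : ∀ e ∈ c.done, e ∈ H ∧ e.2 ∈ c.attr := by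
  refine h.invariant (p := fun c => ∀ e ∈ c.done, e ∈ H ∧ e.2 ∈ c.attr) ?_ (by simp)
  intro x y hxy hx e he
  have hsub := hxy.attr_subset
  obtain ⟨u, v, huv, hv, -, hd, -⟩ := hxy
  rw [hd, mem_insert] at he
  rcases he with rfl | he
  · exact ⟨huv, hsub hv⟩
  · exact ⟨(hx e he).1, hsub (hx e he).2⟩

/-- A player state with an edge worked on has been found, and so has each state all of whose edges
have been worked on, if there are any. -/
theorem Search.found_invariant {k : ℕ} {U : Finset V} {c : Search V}
    (h : Steps (Search.Step P H) k ⟨U, ∅⟩ c) :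
    ∀ e ∈ c.done, (e.1 ∈ P ∨ ∀ w, (e.1, w) ∈ H → (e.1, w) ∈ c.done) → e.1 ∈ c.attr := by
  refine h.invariant (p := fun c => ∀ e ∈ c.done,
    (e.1 ∈ P ∨ ∀ w, (e.1, w) ∈ H → (e.1, w) ∈ c.done) → e.1 ∈ c.attr) ?_ (by simp)
  intro x y hxy hx e he hP
  have hsub := hxy.attr_subset
  obtain ⟨u, v, huv, hv, -, hd, ha⟩ := hxy
  -- The step works on an edge of `u` only, so the premise can become true for no other state.
  by_cases hu : e.1 = u
  · rw [hu] at hP ⊢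
    rw [ha, if_pos hP]
    exact mem_insert_self _ _
  · have hne : ∀ w, (e.1, w) ≠ (u, v) := fun w hw => hu (Prod.ext_iff.mp hw).1
    rw [hd] at he hP
    refine hsub (hx e ((mem_insert.mp he).resolve_left fun h => hne e.2 h) ?_)
    exact hP.imp_right fun h w hw => (mem_insert.mp (h w hw)).resolve_left (hne w)

/-- The states found stay disjoint from a trap that is disjoint from the target: a set in which the
states of the player have all their edges inside, and the other states have an edge inside. -/
theorem Search.disjoint_invariant {k : ℕ} {U Q : Finset V} {c : Search V}
    (h : Steps (Search.Step P H) k ⟨U, ∅⟩ c) (hU : Disjoint Q U)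
    (hP : ∀ s ∈ Q, s ∈ P → ∀ t, (s, t) ∈ H → t ∈ Q)
    (hP' : ∀ s ∈ Q, s ∉ P → ∃ t ∈ Q, (s, t) ∈ H) : Disjoint Q c.attr := by
  -- The first conjunct is needed for the other player: a state of `Q` found by exhausting its edges
  -- would have its edge into `Q` worked on, so that `Q` would already have been hit.
  refine (h.invariant (p := fun c => (∀ e ∈ c.done, e.2 ∈ c.attr) ∧ Disjoint Q c.attr) ?_
    ⟨by simp, hU⟩).2
  rintro x y hxy ⟨hx, hQ⟩
  have hsub := hxy.attr_subset
  obtain ⟨u, v, huv, hv, -, hd, ha⟩ := hxy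
  have hdone : ∀ e ∈ y.done, e.2 ∈ x.attr := by
    intro e he
    rw [hd, mem_insert] at he
    rcases he with rfl | he
    · exact hv
    · exact hx e he
  refine ⟨fun e he => hsub (hdone e he), ?_⟩
  rw [ha]
  split_ifs with hc
  · rw [disjoint_insert_right]
    refine ⟨fun hu => ?_, hQ⟩
    by_cases huP : u ∈ P
    · exact disjoint_left.mp hQ (hP u hu huP v huv) hv
    · obtain ⟨t, ht, hut⟩ := hP' u hu huP
      exact disjoint_left.mp hQ ht (hdone _ ((hc.resolve_left huP) t hut))
  · exact hQ

theorem Search.step_mk {c : Search V} {u v : V} (huv : (u, v) ∈ H) (hv : v ∈ c.attr)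
    (hd : (u, v) ∉ c.done) :
    Search.Step P H c ⟨if u ∈ P ∨ (∀ w, (u, w) ∈ H → (u, w) ∈ insert (u, v) c.done) then
      insert u c.attr else c.attr, insert (u, v) c.done⟩ :=
  ⟨u, v, huv, hv, hd, rfl, rfl⟩

theorem Search.Step.card_done {c c' : Search V} (h : Search.Step P H c c') :
    #c'.done = #c.done + 1 := by
  obtain ⟨u, v, -, -, hn, hd, -⟩ := h
  rw [hd, card_insert_of_notMem hn]

theorem AttrRun.exists (P : Finset V) (H : Finset (V × V)) (U : Finset V) :
    ∃ A work, AttrRun P H U A work := by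
  -- No search makes `#H + 1` steps, because each one uses a new edge of `H`; so the cut-off is
  -- never the reason for stopping.
  obtain ⟨k, ⟨A, D⟩, h, hk, hs⟩ :=
    Steps.exists_stopped (r := Search.Step P H) (⟨U, ∅⟩ : Search V) (#H + 1)
  refine ⟨A, #U + k, k, D, h, hs.resolve_left ?_, rfl⟩
  have h1 := h.measure_eq (f := fun c => #c.done) fun x y hxy => hxy.card_done
  have h2 : #D ≤ #H := card_le_card fun e he => (Search.done_invariant h e he).1
  simp only [card_empty, zero_add] at h1
  omega

variable {U A : Finset V} {work : ℕ}

theorem AttrRun.subset (h : AttrRun P H U A work) : U ⊆ A := by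
  obtain ⟨k, D, h, -⟩ := h
  exact h.invariant (p := fun c => U ⊆ c.attr) (fun x y hxy hx => hx.trans hxy.attr_subset)
    Subset.rfl

theorem AttrRun.subset_of_closed (h : AttrRun P H U A work) {X : Finset V} (hU : U ⊆ X)
    (hX : ∀ e ∈ H, e.1 ∈ X) : A ⊆ X := by
  obtain ⟨k, D, h, -⟩ := h
  refine h.invariant (p := fun c => c.attr ⊆ X) ?_ hU
  rintro x y ⟨u, v, huv, -, -, -, ha⟩ hx
  rw [ha]
  split_ifs
  · exact insert_subset (hX _ huv) hx
  · exact hx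

theorem AttrRun.disjoint (h : AttrRun P H U A work) {Q : Finset V} (hU : Disjoint Q U)
    (hP : ∀ s ∈ Q, s ∈ P → ∀ t, (s, t) ∈ H → t ∈ Q)
    (hP' : ∀ s ∈ Q, s ∉ P → ∃ t ∈ Q, (s, t) ∈ H) : Disjoint Q A := by
  obtain ⟨k, D, h, -⟩ := h
  exact Search.disjoint_invariant h hU hP hP'

theorem AttrRun.eq_empty (h : AttrRun P H ∅ A work) : A = ∅ := by
  obtain ⟨k, D, h, -⟩ := h
  refine h.invariant (p := fun c => c.attr = ∅) ?_ rfl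
  rintro x y ⟨u, v, -, hv, -⟩ hx
  simp [hx] at hv

theorem AttrRun.work_le (h : AttrRun P H U A work) :
    work ≤ #U + #(H.filter fun e => e.2 ∈ A) := by
  obtain ⟨k, D, h, -, rfl⟩ := h
  have h1 := h.measure_eq (f := fun c => #c.done) fun x y hxy => hxy.card_done
  have h2 : #D ≤ #(H.filter fun e => e.2 ∈ A) :=
    card_le_card fun e he => mem_filter.mpr (Search.done_invariant h e he)
  simp only [card_empty, zero_add] at h1
  omega

/-- A player state with an edge into the attractor belongs to it. -/
theorem AttrRun.mem_of_edge (h : AttrRun P H U A work) {u v : V} (hu : u ∈ P)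
    (huv : (u, v) ∈ H) (hv : v ∈ A) : u ∈ A := by
  obtain ⟨k, D, h, hs, -⟩ := h
  have hd : (u, v) ∈ D := by
    by_contra hd
    exact hs _ (Search.step_mk huv hv hd)
  exact Search.found_invariant h _ hd (.inl hu)

/-- A state outside the attractor that has an edge has an edge that avoids the attractor. -/
theorem AttrRun.exists_edge (h : AttrRun P H U A work) {u v : V} (hu : u ∉ A)
    (huv : (u, v) ∈ H) : ∃ w, (u, w) ∈ H ∧ w ∉ A := by
  obtain ⟨k, D, h, hs, -⟩ := h
  by_contra! hw
  have hd : ∀ w, (u, w) ∈ H → (u, w) ∈ D := by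
    intro w huw
    by_contra hd
    exact hs _ (Search.step_mk huw (hw w huw) hd)
  exact hu (Search.found_invariant h _ (hd v huv) (.inr hd))

end Attractor

/-! ### Breadth-first search: levels and explored depth -/

namespace BFS

variable {α : Type*} [DecidableEq α] {N : α → Finset α} {r : α}

/-- The facts about a breadth-first search that hold throughout: the discovered states other than
the root have explored tree edges, and the frontier is one level thick. -/
structure Inv (N : α → Finset α) (r : α) (b : BFS α) : Prop where
  root_mem : r ∈ b.disc
  root_depth : b.depth r = 0
  expl_mem : ∀ e ∈ b.expl, e.1 ∈ b.disc ∧ e.2 ∈ N e.1 ∧ e.2 ∈ b.disc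
  depth_le : ∀ e ∈ b.expl, b.depth e.2 ≤ b.depth e.1 + 1
  parent : ∀ x ∈ b.disc, x = r ∨ ∃ p, (p, x) ∈ b.expl ∧ b.depth x = b.depth p + 1
  thick : ∀ x ∈ b.disc, ∀ f ∈ b.frontier N, b.depth x ≤ b.depth f + 1
  expl_le : ∀ e ∈ b.expl, ∀ f ∈ b.frontier N, b.depth e.1 ≤ b.depth f

theorem mem_frontier {b : BFS α} {u : α} :
    u ∈ b.frontier N ↔ u ∈ b.disc ∧ ∃ t ∈ N u, (u, t) ∉ b.expl := mem_filter

theorem inv_init (N : α → Finset α) (r : α) : Inv N r (init r) where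
  root_mem := by simp [init]
  root_depth := rfl
  expl_mem := by simp [init]
  depth_le := by simp [init]
  parent := by simp [init]
  thick := by simp [init]
  expl_le := by simp [init]

/-- The explored edge leaves a frontier state `u` of least depth. So a new state, of depth one more,
keeps the frontier one level thick, and an old endpoint is at most one level below `u` because of
`thick`. -/
theorem Inv.step {b b' : BFS α} (h : Inv N r b) (hs : Step N b b') : Inv N r b' := by
  obtain ⟨u, hu, hmin, t, ht, hut, rfl⟩ := hs
  have hud := (mem_frontier.mp hu).1
  split_ifs with htd
  · have hfr : ∀ f, f ∈ BFS.frontier N ⟨b.disc, b.depth, insert (u, t) b.expl⟩ →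
        f ∈ b.frontier N := by
      intro f hf
      obtain ⟨h1, w, hw, hw'⟩ := mem_frontier.mp hf
      exact mem_frontier.mpr ⟨h1, w, hw, fun h => hw' (mem_insert_of_mem h)⟩
    refine ⟨h.root_mem, h.root_depth, ?_, ?_, ?_, ?_, ?_⟩
    · intro e he
      rcases mem_insert.mp he with rfl | he
      · exact ⟨hud, ht, htd⟩
      · exact h.expl_mem e he
    · intro e he
      rcases mem_insert.mp he with rfl | he
      · exact h.thick t htd u hu
      · exact h.depth_le e he
    · intro x hx
      refine (h.parent x hx).imp_right ?_
      rintro ⟨p, hp, hd⟩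
      exact ⟨p, mem_insert_of_mem hp, hd⟩
    · intro x hx f hf
      exact h.thick x hx f (hfr f hf)
    · intro e he f hf
      rcases mem_insert.mp he with rfl | he
      · exact hmin f (hfr f hf)
      · exact h.expl_le e he f (hfr f hf)
  · set dep := Function.update b.depth t (b.depth u + 1) with hdep
    have hdt : dep t = b.depth u + 1 := Function.update_self ..
    have hdx : ∀ x ∈ b.disc, dep x = b.depth x := fun x hx =>
      Function.update_of_ne (ne_of_mem_of_not_mem hx htd) ..
    have hfr : ∀ f, f ∈ BFS.frontier N ⟨insert t b.disc, dep, insert (u, t) b.expl⟩ →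
        f = t ∨ f ∈ b.frontier N := by
      intro f hf
      obtain ⟨h1, w, hw, hw'⟩ := mem_frontier.mp hf
      rcases mem_insert.mp h1 with rfl | h1
      · exact .inl rfl
      · exact .inr (mem_frontier.mpr ⟨h1, w, hw, fun h => hw' (mem_insert_of_mem h)⟩)
    have hfd : ∀ f, f ∈ BFS.frontier N ⟨insert t b.disc, dep, insert (u, t) b.expl⟩ →
        b.depth u ≤ dep f := by
      intro f hf
      rcases hfr f hf with rfl | hf
      · omega
      · rw [hdx f (mem_frontier.mp hf).1]
        exact hmin f hf
    refine ⟨mem_insert_of_mem h.root_mem, ?_, ?_, ?_, ?_, ?_, ?_⟩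
    · exact (hdx r h.root_mem).trans h.root_depth
    · intro e he
      rcases mem_insert.mp he with rfl | he
      · exact ⟨mem_insert_of_mem hud, ht, mem_insert_self _ _⟩
      · obtain ⟨h1, h2, h3⟩ := h.expl_mem e he
        exact ⟨mem_insert_of_mem h1, h2, mem_insert_of_mem h3⟩
    · intro e he
      change dep e.2 ≤ dep e.1 + 1
      rcases mem_insert.mp he with rfl | he
      · rw [hdt, hdx u hud]
      · obtain ⟨h1, -, h3⟩ := h.expl_mem e he
        rw [hdx _ h1, hdx _ h3]
        exact h.depth_le e he
    · intro x hx
      rcases mem_insert.mp hx with rfl | hx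
      · refine .inr ⟨u, mem_insert_self _ _, ?_⟩
        change dep x = dep u + 1
        rw [hdt, hdx u hud]
      · refine (h.parent x hx).imp_right ?_
        rintro ⟨p, hp, hd⟩
        refine ⟨p, mem_insert_of_mem hp, ?_⟩
        change dep x = dep p + 1
        rw [hdx x hx, hdx p (h.expl_mem _ hp).1, hd]
    · intro x hx f hf
      change dep x ≤ dep f + 1
      have := hfd f hf
      rcases mem_insert.mp hx with rfl | hxd
      · omega
      · rw [hdx x hxd]
        rcases hfr f hf with rfl | hf
        · have := h.thick x hxd u hu
          omega
        · rw [hdx f (mem_frontier.mp hf).1]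
          exact h.thick x hxd f hf
    · intro e he f hf
      change dep e.1 ≤ dep f
      have := hfd f hf
      rcases mem_insert.mp he with rfl | he
      · rwa [hdx u hud]
      · have := h.expl_le e he u hu
        rw [hdx _ (h.expl_mem e he).1]
        omega

theorem Step.card_expl {b b' : BFS α} (h : Step N b b') : #b'.expl = #b.expl + 1 := by
  obtain ⟨u, -, -, t, -, hut, rfl⟩ := h
  split_ifs <;> exact card_insert_of_notMem hut

theorem Step.card_disc_le {b b' : BFS α} (h : Step N b b') : #b'.disc ≤ #b.disc + 1 := by
  obtain ⟨u, -, -, t, -, hut, rfl⟩ := h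
  split_ifs
  · exact Nat.le_succ _
  · exact card_insert_le _ _

theorem exists_step {b : BFS α} (h : (b.frontier N).Nonempty) : ∃ b', Step N b b' := by
  obtain ⟨u, hu, hmin⟩ := exists_min_image (b.frontier N) b.depth h
  obtain ⟨t, ht, hut⟩ := (mem_frontier.mp hu).2
  exact ⟨_, u, hu, hmin, t, ht, hut, rfl⟩

theorem Run.exists (N : α → Finset α) (r : α) (K : ℕ) : ∃ k b, Run N r K k b :=
  Steps.exists_stopped _ _

variable {K k : ℕ} {b : BFS α}

theorem Run.inv (h : Run N r K k b) : Inv N r b :=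
  h.1.invariant (p := Inv N r) (fun _ _ hs hx => hx.step hs) (inv_init N r)

theorem Run.card_expl (h : Run N r K k b) : #b.expl = k := by
  simpa [init] using h.1.measure_eq (f := fun b => #b.expl) fun _ _ hs => hs.card_expl

theorem Run.card_disc_le (h : Run N r K k b) : #b.disc ≤ k + 1 := by
  obtain ⟨h, -⟩ := h
  generalize hc : init r = c at h
  induction h with
  | refl => simp [← hc, init]
  | tail _ hs ih =>
    have := hs.card_disc_le
    have := ih hc
    omega

/-- The level sets of the search grow by at most the out-degree. -/
theorem Inv.card_level_le (h : Inv N r b) {Δ : ℕ} (hΔ : ∀ u, u ≠ r → #(N u) ≤ Δ) (j : ℕ) :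
    #(b.disc.filter fun x => x ≠ r ∧ b.depth x = j + 1) ≤ #(N r) * Δ ^ j := by
  induction j with
  | zero =>
    rw [pow_zero, mul_one]
    refine card_le_card fun x hx => ?_
    obtain ⟨hx, hxr, hd⟩ := mem_filter.mp hx
    obtain ⟨p, hp, hd'⟩ := (h.parent x hx).resolve_left hxr
    rcases h.parent p (h.expl_mem _ hp).1 with rfl | ⟨p', -, hd''⟩
    · exact (h.expl_mem _ hp).2.1
    · omega
  | succ j ih =>
    calc _ ≤ #((b.disc.filter fun x => x ≠ r ∧ b.depth x = j + 1).biUnion N) := by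
          refine card_le_card fun x hx => ?_
          obtain ⟨hx, hxr, hd⟩ := mem_filter.mp hx
          obtain ⟨p, hp, hd'⟩ := (h.parent x hx).resolve_left hxr
          refine mem_biUnion.mpr ⟨p, mem_filter.mpr ⟨(h.expl_mem _ hp).1, ?_, by omega⟩,
            (h.expl_mem _ hp).2.1⟩
          rintro rfl
          have := h.root_depth
          omega
      _ ≤ #(b.disc.filter fun x => x ≠ r ∧ b.depth x = j + 1) * Δ :=
          card_biUnion_le_card_mul _ _ _ fun x hx => hΔ x (mem_filter.mp hx).2.1
      _ ≤ #(N r) * Δ ^ j * Δ := Nat.mul_le_mul_right _ ih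
      _ = _ := by rw [pow_succ, mul_assoc]

/-- The number of explored edges that leave a state of given depth. -/
theorem Inv.card_expl_level_le (h : Inv N r b) {Δ : ℕ} (hΔ : ∀ u, u ≠ r → #(N u) ≤ Δ) (j : ℕ) :
    #(b.expl.filter fun e => b.depth e.1 = j) ≤ #(N r) * Δ ^ j := by
  have hsub : ∀ S : Finset α, (∀ e ∈ b.expl, b.depth e.1 = j → e.1 ∈ S) →
      #(b.expl.filter fun e => b.depth e.1 = j) ≤ ∑ u ∈ S, #(N u) := by
    intro S hS
    rw [← card_sigma]
    refine card_le_card_of_injOn (fun e => ⟨e.1, e.2⟩) ?_ ?_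
    · intro e he
      obtain ⟨he, hd⟩ := mem_filter.mp he
      exact mem_sigma.mpr ⟨hS e he hd, (h.expl_mem e he).2.1⟩
    · rintro ⟨a, b⟩ - ⟨c, d⟩ - hac
      simpa using hac
  cases j with
  | zero =>
    simpa using hsub {r} fun e he hd => by
      rcases h.parent _ (h.expl_mem e he).1 with hr | ⟨p, -, hp⟩
      · simpa using hr
      · omega
  | succ j =>
    calc _ ≤ ∑ u ∈ b.disc.filter fun x => x ≠ r ∧ b.depth x = j + 1, #(N u) := by
          refine hsub _ fun e he hd => mem_filter.mpr ⟨(h.expl_mem e he).1, ?_, hd⟩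
          intro hr
          have := h.root_depth
          rw [hr] at hd
          omega
      _ ≤ #(b.disc.filter fun x => x ≠ r ∧ b.depth x = j + 1) * Δ := by
          rw [← smul_eq_mul]
          exact sum_le_card_nsmul _ _ _ fun x hx => hΔ x (mem_filter.mp hx).2.1
      _ ≤ #(N r) * Δ ^ j * Δ := Nat.mul_le_mul_right _ (h.card_level_le hΔ j)
      _ = _ := by rw [pow_succ, mul_assoc]

/-- A search that runs for long enough has explored all edges that leave states of small depth. -/
theorem Run.lt_depth (h : Run N r K k b) {Δ d : ℕ} (hΔ2 : 2 ≤ Δ)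
    (hΔ : ∀ u, u ≠ r → #(N u) ≤ Δ) (hK : #(N r) * Δ ^ (d + 1) < K) {f : α}
    (hf : f ∈ b.frontier N) : d < b.depth f := by
  by_contra! hd
  -- A nonempty frontier means that the search was cut off, so it has explored exactly `K` edges.
  -- All of them leave states of depth at most `d`, which are too few to supply `K` edges.
  have hk : k = K := h.2.2.resolve_right fun hn =>
    let ⟨b', hb'⟩ := exists_step ⟨f, hf⟩
    hn b' hb'
  have h1 : b.expl ⊆ (range (d + 1)).biUnion fun j => b.expl.filter fun e => b.depth e.1 = j := by
    intro e he
    refine mem_biUnion.mpr ⟨b.depth e.1, mem_range.mpr ?_, mem_filter.mpr ⟨he, rfl⟩⟩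
    exact Nat.lt_succ_of_le ((h.inv.expl_le e he f hf).trans hd)
  have h2 : #b.expl ≤ ∑ j ∈ range (d + 1), #(N r) * Δ ^ j :=
    (card_le_card h1).trans (card_biUnion_le.trans
      (sum_le_sum fun j _ => h.inv.card_expl_level_le hΔ j))
  rw [← mul_sum, h.card_expl, hk] at h2
  have h3 : ∑ j ∈ range (d + 1), Δ ^ j < Δ ^ (d + 1) :=
    Nat.geomSum_lt hΔ2 fun j hj => mem_range.mp hj
  have := Nat.mul_le_mul_left #(N r) h3.le
  omega

end BFS

/-! ### Traps in subgames -/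

namespace GameGraph

variable {V : Type*} [Fintype V] [DecidableEq V] {G : GameGraph V} {B X W W' Q : Finset V}

/-- Each state of `X` keeps a successor in the subgame on `X`. -/
def Closed (G : GameGraph V) (X : Finset V) : Prop := ∀ s ∈ X, (G.succ s ∩ X).Nonempty

/-- In the subgame on `X`, player 1 cannot leave `Q`, player 2 can stay in `Q`, and `Q` is
nonempty and avoids `B`. -/
structure IsTrap (G : GameGraph V) (B X Q : Finset V) : Prop where
  nonempty : Q.Nonempty
  subset : Q ⊆ X
  disjoint : Disjoint Q B
  player1 : ∀ s ∈ Q, s ∈ G.player1 → ∀ t ∈ G.succ s, t ∈ X → t ∈ Q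
  player2 : ∀ s ∈ Q, s ∉ G.player1 → ∃ t ∈ Q, t ∈ G.succ s

/-- Each trap with at most `d` states has a state with an edge into `W`. -/
def Clean (G : GameGraph V) (B : Finset V) (d : ℕ) (X W : Finset V) : Prop :=
  ∀ Q, G.IsTrap B X Q → #Q ≤ d → ¬ Disjoint Q (G.source W)

theorem mem_edges {e : V × V} : e ∈ G.edges X ↔ e.1 ∈ X ∧ e.2 ∈ X ∧ e.2 ∈ G.succ e.1 := by
  simp [edges]

theorem edges_mono (h : X ⊆ W) : G.edges X ⊆ G.edges W := fun _ he =>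
  let ⟨h1, h2, h3⟩ := mem_edges.mp he
  mem_edges.mpr ⟨h h1, h h2, h3⟩

theorem card_edges_univ (G : GameGraph V) : #(G.edges univ) = G.numEdges := by
  rw [numEdges, ← card_sigma]
  refine card_bij' (fun e _ => ⟨e.1, e.2⟩) (fun e _ => (e.1, e.2)) ?_ ?_ ?_ ?_ <;>
    simp [mem_edges]

theorem card_edges_le (G : GameGraph V) (X : Finset V) : #(G.edges X) ≤ G.numEdges :=
  (card_le_card (edges_mono (subset_univ X))).trans G.card_edges_univ.le

theorem card_le_numEdges (G : GameGraph V) : Fintype.card V ≤ G.numEdges := by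
  rw [numEdges, ← card_univ, card_eq_sum_ones]
  exact sum_le_sum fun s _ => (G.succ_nonempty s).card_pos

theorem mem_source {s : V} {U : Finset V} : s ∈ G.source U ↔ ∃ t ∈ G.succ s, t ∈ U := by
  simp [source, Finset.Nonempty]

theorem card_source_le (G : GameGraph V) (U : Finset V) :
    #(G.source U) ≤ #((G.edges univ).filter fun e => e.2 ∈ U) := by
  refine (card_le_card fun s hs => ?_).trans (card_image_le (f := Prod.fst))
  obtain ⟨t, ht, htU⟩ := mem_source.mp hs
  exact mem_image.mpr ⟨(s, t), mem_filter.mpr ⟨mem_edges.mpr ⟨mem_univ _, mem_univ _, ht⟩, htU⟩,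
    rfl⟩

theorem AttrRun.subset_states {P U A : Finset V} {c : ℕ} (h : AttrRun P (G.edges X) U A c)
    (hU : U ⊆ X) : A ⊆ X :=
  h.subset_of_closed hU fun _ he => (mem_edges.mp he).1

/-- A state with an edge stays outside an attractor only by having an edge that avoids it. This
holds for either player's attractor: it keeps the subgames closed, and it lets player 2 stay in the
complement of a player 1 attractor. -/
theorem Closed.sdiff (hX : G.Closed X) {P U : Finset V} {c : ℕ}
    (h : AttrRun P (G.edges X) U W' c) : G.Closed (X \ W') := by
  intro s hs
  obtain ⟨hsX, hs⟩ := mem_sdiff.mp hs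
  obtain ⟨t, ht⟩ := hX s hsX
  obtain ⟨ht, htX⟩ := mem_inter.mp ht
  obtain ⟨w, hw, hw'⟩ := h.exists_edge hs (mem_edges.mpr ⟨hsX, htX, ht⟩)
  obtain ⟨-, hwX, hws⟩ := mem_edges.mp hw
  exact ⟨w, mem_inter.mpr ⟨hws, mem_sdiff.mpr ⟨hwX, hw'⟩⟩⟩

/-- A trap without an edge into the states just removed has been a trap before. -/
theorem IsTrap.of_sdiff (h : G.IsTrap B (X \ W) Q) (hQ : Disjoint Q (G.source W)) :
    G.IsTrap B X Q where
  nonempty := h.nonempty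
  subset := h.subset.trans sdiff_subset
  disjoint := h.disjoint
  player1 s hs hs1 t ht htX := h.player1 s hs hs1 t ht <| mem_sdiff.mpr ⟨htX, fun htW =>
    disjoint_left.mp hQ hs (mem_source.mpr ⟨t, ht, htW⟩)⟩
  player2 := h.player2

/-! ### The classical procedure finds and removes all traps -/

section Classical

variable {c : ℕ}

theorem AvoidSetClassical.subset (h : G.AvoidSetClassical B X W' c) : W' ⊆ X := by
  obtain ⟨R, c₁, c₂, -, h2, -⟩ := h
  exact AttrRun.subset_states h2 sdiff_subset

theorem AvoidSetClassical.closed (h : G.AvoidSetClassical B X W' c) (hX : G.Closed X) :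
    G.Closed (X \ W') := by
  obtain ⟨R, c₁, c₂, -, h2, -⟩ := h
  exact hX.sdiff h2

/-- `AvoidSetClassical` removes all traps. -/
theorem AvoidSetClassical.trap_subset (h : G.AvoidSetClassical B X W' c)
    (hQ : G.IsTrap B X Q) : Q ⊆ W' := by
  obtain ⟨R, c₁, c₂, h1, h2, -⟩ := h
  have hd : Disjoint Q R := by
    refine h1.disjoint (hQ.disjoint.mono_right inter_subset_left) ?_ ?_
    · intro s hs hs1 t ht
      obtain ⟨-, htX, ht⟩ := mem_edges.mp ht
      exact hQ.player1 s hs hs1 t ht htX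
    · intro s hs hs1
      obtain ⟨t, htQ, ht⟩ := hQ.player2 s hs hs1
      exact ⟨t, htQ, mem_edges.mpr ⟨hQ.subset hs, hQ.subset htQ, ht⟩⟩
  exact fun s hs => h2.subset (mem_sdiff.mpr ⟨hQ.subset hs, disjoint_left.mp hd hs⟩)

/-- If `AvoidSetClassical` removes anything, then it has found a trap. -/
theorem AvoidSetClassical.exists_trap (h : G.AvoidSetClassical B X W' c) (hX : G.Closed X)
    (hW : W'.Nonempty) : ∃ Q, G.IsTrap B X Q := by
  obtain ⟨R, c₁, c₂, h1, h2, -⟩ := h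
  refine ⟨X \ R, ?_, sdiff_subset, ?_, ?_, ?_⟩
  · rw [nonempty_iff_ne_empty]
    intro hR
    rw [hR] at h2
    exact hW.ne_empty h2.eq_empty
  · rw [disjoint_left]
    intro s hs hsB
    obtain ⟨hsX, hs⟩ := mem_sdiff.mp hs
    exact hs (h1.subset (mem_inter.mpr ⟨hsB, hsX⟩))
  · intro s hs hs1 t ht htX
    obtain ⟨hsX, hs⟩ := mem_sdiff.mp hs
    exact mem_sdiff.mpr ⟨htX, fun htR => hs (h1.mem_of_edge hs1 (mem_edges.mpr ⟨hsX, htX, ht⟩) htR)⟩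
  · intro s hs _
    obtain ⟨t, ht⟩ := (hX.sdiff h1) s hs
    obtain ⟨ht, htX⟩ := mem_inter.mp ht
    exact ⟨t, htX, ht⟩

theorem AvoidSetClassical.work_le (h : G.AvoidSetClassical B X W' c) : c ≤ 6 * G.numEdges := by
  obtain ⟨R, c₁, c₂, h1, h2, rfl⟩ := h
  have e1 := h1.work_le
  have e2 := h2.work_le
  have e3 : #(B ∩ X) ≤ Fintype.card V := card_le_univ _
  have e4 : #(X \ R) ≤ Fintype.card V := card_le_univ _
  have e5 : #X ≤ Fintype.card V := card_le_univ _
  have e6 := (card_filter_le (G.edges X) fun e => e.2 ∈ R).trans (G.card_edges_le X)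
  have e7 := (card_filter_le (G.edges X) fun e => e.2 ∈ W').trans (G.card_edges_le X)
  have := G.card_le_numEdges
  omega

theorem AvoidSetClassical.exists (G : GameGraph V) (B X : Finset V) :
    ∃ W' c, G.AvoidSetClassical B X W' c := by
  obtain ⟨R, c₁, h1⟩ := AttrRun.exists G.player1 (G.edges X) (B ∩ X)
  obtain ⟨A, c₂, h2⟩ := AttrRun.exists G.player1ᶜ (G.edges X) (X \ R)
  exact ⟨A, _, R, c₁, c₂, h1, h2, rfl⟩

end Classical

/-! ### The forward exploration finds small traps -/

section Forward

variable {β : ℝ} {Tr U : Finset V} {c : ℕ}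

theorem Forward.exists (G : GameGraph V) (β : ℝ) (B X W : Finset V) :
    ∃ Tr c, G.Forward β B X W Tr c := by
  obtain ⟨k, b, hb⟩ := BFS.Run.exists (G.auxSucc X (G.source W ∩ X)) none ⌊2 * G.threshold β⌋₊
  obtain ⟨A, c, h⟩ := AttrRun.exists G.player1
    (univ.filter fun e : V × V => (some e.1, some e.2) ∈ b.expl)
    ((univ.filter fun v => some v ∈ b.disc) ∩ B ∪
      (univ.filter fun v => some v ∈ b.frontier (G.auxSucc X (G.source W ∩ X))).filter
        fun s => s ∈ G.player1 ∨
          ∀ t, (s, t) ∉ univ.filter fun e : V × V => (some e.1, some e.2) ∈ b.expl)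
  exact ⟨_, _, k, b, hb, _, _, _, A, _, c, rfl, rfl, rfl, rfl, h, rfl, rfl⟩

theorem mem_of_mem_auxSucc (hU : U ⊆ X) {x : Option V} {v : V}
    (h : some v ∈ G.auxSucc X U x) : v ∈ X := by
  cases x with
  | none => exact hU (by simpa [auxSucc] using h)
  | some u =>
    have : v ∈ G.succ u ∧ v ∈ X := by simpa [auxSucc] using h
    exact this.2

theorem some_mem_auxSucc {u v : V} :
    some v ∈ G.auxSucc X U (some u) ↔ v ∈ G.succ u ∧ v ∈ X := by
  simp [auxSucc]

theorem card_auxSucc_none : #(G.auxSucc X U none) = #U :=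
  card_image_of_injective _ (Option.some_injective _)

theorem card_auxSucc_le {x : Option V} (hx : x ≠ none) : #(G.auxSucc X U x) ≤ G.maxOutdeg := by
  cases x with
  | none => exact absurd rfl hx
  | some u =>
    calc #(G.auxSucc X U (some u)) ≤ #(G.succ u ∩ X) := card_image_le
      _ ≤ #(G.succ u) := card_le_card inter_subset_left
      _ ≤ G.maxOutdeg := le_sup (f := fun s => #(G.succ s)) (mem_univ u)

theorem Forward.subset (h : G.Forward β B X W Tr c) : Tr ⊆ X := by
  obtain ⟨k, b, hb, R, F, T, A, H, c, rfl, rfl, rfl, rfl, -, rfl, -⟩ := h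
  intro v hv
  have hv : some v ∈ b.disc := (mem_filter.mp (mem_sdiff.mp hv).1).2
  obtain ⟨p, hp, -⟩ := (hb.inv.parent _ hv).resolve_left (by simp)
  exact mem_of_mem_auxSucc inter_subset_right (hb.inv.expl_mem _ hp).2.1

/-- A search of `k` steps discovers at most `k` states besides the root and explores `k` edges. The
factor 5 counts the search, the two passes over `R`, and the target states and edges of the
attractor computation. -/
theorem Forward.work_le (h : G.Forward β B X W Tr c) :
    c ≤ #(G.source W) + 5 * ⌊2 * G.threshold β⌋₊ := by
  obtain ⟨k, b, hb, R, F, T, A, H, c, hR, hH, hF, hT, hA, -, rfl⟩ := h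
  have e1 : #R + 1 ≤ k + 1 := by
    refine le_trans ?_ hb.card_disc_le
    rw [← card_erase_add_one hb.inv.root_mem]
    refine Nat.succ_le_succ ?_
    rw [← card_image_of_injective R (Option.some_injective V)]
    refine card_le_card fun x hx => ?_
    obtain ⟨v, hv, rfl⟩ := mem_image.mp hx
    rw [hR] at hv
    exact mem_erase.mpr ⟨by simp, (mem_filter.mp hv).2⟩
  have e2 : #H ≤ k := by
    rw [← hb.card_expl]
    refine card_le_card_of_injOn (fun e => (some e.1, some e.2)) ?_ ?_
    · intro e he
      rw [hH] at he
      exact (mem_filter.mp he).2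
    · rintro ⟨a, b⟩ - ⟨c, d⟩ - h
      simpa using h
  have e3 : #(R ∩ B ∪ T) ≤ #R := by
    refine card_le_card (union_subset inter_subset_left ?_)
    rw [hT, hF, hR]
    intro v hv
    have := (mem_filter.mp (mem_filter.mp hv).1).2
    exact mem_filter.mpr ⟨mem_univ _, (BFS.mem_frontier.mp this).1⟩
  have e4 := hA.work_le
  have e5 := card_filter_le H fun e => e.2 ∈ A
  have e6 : #(G.source W ∩ X) ≤ #(G.source W) := card_le_card inter_subset_left
  have e7 := hb.2.1
  omega

/-- An increasing sequence of subsets of a set with at most `d` elements is constant from some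
index `j ≤ d` to the next, if it starts with a nonempty set at index one. -/
theorem exists_stationary {α : Type*} {D : ℕ → Finset α} {S : Finset α} {d : ℕ}
    (hD : ∀ j, D j ⊆ D (j + 1)) (hQ : ∀ j, D j ⊆ S) (h1 : (D 1).Nonempty) (hd : #S ≤ d) :
    ∃ j, 1 ≤ j ∧ j ≤ d ∧ D (j + 1) = D j := by
  by_contra! h
  have hlt : ∀ j, j ≤ d → j + 1 ≤ #(D (j + 1)) := by
    intro j
    induction j with
    | zero => exact fun _ => h1.card_pos
    | succ j ih =>
      intro hj
      have h2 := card_lt_card ((hD (j + 1)).ssubset_of_ne (h (j + 1) (by omega) hj).symm)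
      have := ih (by omega)
      omega
  have h2 := hlt d le_rfl
  have h3 := card_le_card (hQ (d + 1))
  omega

/-- The forward exploration finds a part of each small trap that has an edge into `W`. -/
theorem Forward.finds_trap (h : G.Forward β B X W Tr c) {d Δ : ℕ} (hΔ2 : 2 ≤ Δ)
    (hΔ : G.maxOutdeg ≤ Δ) (hK : #(G.source W) * Δ ^ (d + 1) < ⌊2 * G.threshold β⌋₊)
    (hQ : G.IsTrap B X Q) (hQd : #Q ≤ d) (hQW : ¬ Disjoint Q (G.source W)) :
    (Q ∩ Tr).Nonempty := by
  obtain ⟨k, b, hb, R, F, T, A, H, c, hR, hH, hF, hT, hA, rfl, -⟩ := h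
  set N := G.auxSucc X (G.source W ∩ X) with hN
  -- The root has out-degree at most `#(G.source W)`, every other state at most `Δ`.
  have hfr : ∀ x ∈ b.frontier N, d < b.depth x := fun x hx =>
    hb.lt_depth hΔ2 (fun u hu => (card_auxSucc_le hu).trans hΔ)
      ((Nat.mul_le_mul_right _ (card_auxSucc_none.trans_le
        (card_le_card inter_subset_left))).trans_lt hK) hx
  have hexpl : ∀ x ∈ b.disc, b.depth x ≤ d → ∀ t ∈ N x, (x, t) ∈ b.expl := by
    intro x hx hxd t ht
    by_contra hxt
    exact (hfr x (BFS.mem_frontier.mpr ⟨hx, t, ht, hxt⟩)).not_ge hxd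
  set D : ℕ → Finset V := fun j => Q.filter fun v => some v ∈ b.disc ∧ b.depth (some v) ≤ j with hD
  have hmem : ∀ {j v}, v ∈ D j ↔ v ∈ Q ∧ some v ∈ b.disc ∧ b.depth (some v) ≤ j := mem_filter
  have hone : (D 1).Nonempty := by
    obtain ⟨q, hq, hqW⟩ := not_disjoint_iff.mp hQW
    have he : (none, some q) ∈ b.expl := by
      refine hexpl none hb.inv.root_mem (hb.inv.root_depth.trans_le (Nat.zero_le d)) _ ?_
      exact mem_image_of_mem _ (mem_inter.mpr ⟨hqW, hQ.subset hq⟩)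
    have := hb.inv.depth_le _ he
    rw [hb.inv.root_depth] at this
    exact ⟨q, hmem.mpr ⟨hq, (hb.inv.expl_mem _ he).2.2, this⟩⟩
  -- At a depth `j` where no further trap state appears, `D j` is closed under edges into `Q`, and
  -- `j ≤ d` ensures that all these edges have been explored.
  obtain ⟨j, hj1, hjd, hj⟩ := exists_stationary (D := D)
    (fun j v hv => by
      obtain ⟨h1, h2, h3⟩ := hmem.mp hv
      exact hmem.mpr ⟨h1, h2, h3.trans j.le_succ⟩)
    (fun j => filter_subset _ _) hone hQd
  have hstep : ∀ s ∈ D j, ∀ t ∈ G.succ s, t ∈ Q → t ∈ D j ∧ (s, t) ∈ H := by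
    intro s hs t ht htQ
    obtain ⟨hsQ, hsd, hsj⟩ := hmem.mp hs
    have he := hexpl (some s) hsd (hsj.trans hjd) (some t)
      (some_mem_auxSucc.mpr ⟨ht, hQ.subset htQ⟩)
    have := hb.inv.depth_le _ he
    refine ⟨hj ▸ hmem.mpr ⟨htQ, (hb.inv.expl_mem _ he).2.2, by simp only at this; omega⟩, ?_⟩
    rw [hH]
    exact mem_filter.mpr ⟨mem_univ _, he⟩
  -- `D j` is a trap of the explored subgraph. It misses `B` like `Q`, and it misses `T` because
  -- frontier states lie deeper than `d`.
  have hdis : Disjoint (D j) A := by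
    refine hA.disjoint ?_ ?_ ?_
    · rw [disjoint_left]
      intro v hv hvU
      obtain ⟨hvQ, hvd, hvj⟩ := hmem.mp hv
      rcases mem_union.mp hvU with hvB | hvT
      · exact disjoint_left.mp hQ.disjoint hvQ (mem_inter.mp hvB).2
      · rw [hT, hF] at hvT
        exact (hfr _ (mem_filter.mp (mem_filter.mp hvT).1).2).not_ge (hvj.trans hjd)
    · intro s hs hs1 t ht
      rw [hH] at ht
      obtain ⟨hts, htX⟩ := some_mem_auxSucc.mp (hb.inv.expl_mem _ (mem_filter.mp ht).2).2.1
      exact (hstep s hs t hts (hQ.player1 s (hmem.mp hs).1 hs1 t hts htX)).1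
    · intro s hs hs1
      obtain ⟨t, htQ, ht⟩ := hQ.player2 s (hmem.mp hs).1 hs1
      exact ⟨t, hstep s hs t ht htQ⟩
  have hsub : D 1 ⊆ D j := fun v hv => by
    obtain ⟨h1, h2, h3⟩ := hmem.mp hv
    exact hmem.mpr ⟨h1, h2, h3.trans hj1⟩
  obtain ⟨q, hq⟩ := hone
  obtain ⟨hqQ, hqd, -⟩ := hmem.mp hq
  refine ⟨q, mem_inter.mpr ⟨hqQ, mem_sdiff.mpr ⟨?_, disjoint_left.mp hdis (hsub hq)⟩⟩⟩
  rw [hR]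
  exact mem_filter.mpr ⟨mem_univ _, hqd⟩

end Forward

end GameGraph

/-! ### Amortised analysis of the loop -/

namespace GameGraph

variable {V : Type*} [Fintype V] [DecidableEq V] {G : GameGraph V} {B X W W' Q : Finset V}

/-- A remaining trap without an edge into `W'` would have been a trap of `X`, and all of those have
been removed. -/
theorem AvoidSetClassical.clean {c : ℕ} (h : G.AvoidSetClassical B X W' c) (d : ℕ) :
    G.Clean B d (X \ W') W' := by
  intro Q hQ _ hdis
  obtain ⟨q, hq⟩ := hQ.nonempty
  exact (mem_sdiff.mp (hQ.subset hq)).2 (h.trap_subset (hQ.of_sdiff hdis) hq)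

section Bounds

variable {β τ : ℝ} {d Δ w : ℕ}

/-- What one iteration does: either it runs `AvoidSetClassical`, and then it removes many states
or there is another reason to pay for it; or it removes a set that the forward exploration found,
and then it keeps the graph clean unless `source(W)` is large. -/
theorem Iteration.cost (h : G.Iteration β B X W W' w) (hX : G.Closed X) (hτ : τ ≤ G.threshold β)
    (hθ : 0 ≤ G.threshold β) (hΔ2 : 2 ≤ Δ) (hΔ : G.maxOutdeg ≤ Δ)
    (hK : ∀ s : ℕ, (s : ℝ) < τ → 1 ≤ d → s * Δ ^ (d + 1) < ⌊2 * G.threshold β⌋₊) :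
    W' ⊆ X ∧ G.Closed (X \ W') ∧
      (((w : ℝ) ≤ G.sourceWork W + 11 * G.threshold β + 6 * G.numEdges ∧
        G.Clean B d (X \ W') W' ∧
        (W' = ∅ ∨ τ ≤ #(G.source W) ∨ ¬ G.Clean B d X W ∨ d + 1 ≤ #W')) ∨
      ((w : ℝ) ≤ G.sourceWork W + 11 * G.threshold β + #W' +
          #((G.edges X).filter fun e => e.1 ∈ W' ∨ e.2 ∈ W') ∧
        W'.Nonempty ∧
        (τ ≤ #(G.source W) ∨ ¬ G.Clean B d X W ∨ G.Clean B d (X \ W') W'))) := by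
  have hfw : ∀ {Tr c}, (#(G.source W) : ℝ) < G.threshold β → G.Forward β B X W Tr c →
      (c : ℝ) ≤ 11 * G.threshold β := by
    intro Tr c hs hf
    have h1 : (c : ℝ) ≤ #(G.source W) + 5 * ⌊2 * G.threshold β⌋₊ := mod_cast hf.work_le
    have h2 := Nat.floor_le (mul_nonneg zero_le_two hθ)
    linarith
  have hfind : ∀ {Tr c Q}, ¬ τ ≤ #(G.source W) → G.Forward β B X W Tr c → G.IsTrap B X Q →
      #Q ≤ d → ¬ Disjoint Q (G.source W) → (Q ∩ Tr).Nonempty := by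
    intro Tr c Q hs hf hQ hQd hQW
    -- A trap is nonempty, so `d = 0` needs no exploration bound; this is why `hK` may assume `1 ≤
    -- d`.
    exact hf.finds_trap hΔ2 hΔ (hK _ (not_le.mp hs) (hQ.nonempty.card_pos.trans_le hQd)) hQ hQd hQW
  cases h with
  | @large _ c h hc =>
    refine ⟨hc.subset, hc.closed hX, .inl ⟨?_, hc.clean d, .inr (.inl (hτ.trans h))⟩⟩
    have : (c : ℝ) ≤ 6 * G.numEdges := mod_cast hc.work_le
    push_cast
    linarith
  | @found Tr _ c c' h hf hTr ha =>
    refine ⟨AttrRun.subset_states ha hf.subset, hX.sdiff ha, .inr ⟨?_, hTr.mono ha.subset, ?_⟩⟩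
    · have h1 := hfw h hf
      have h2 : c' ≤ #W' + #((G.edges X).filter fun e => e.1 ∈ W' ∨ e.2 ∈ W') :=
        ha.work_le.trans (add_le_add (card_le_card ha.subset)
          (card_le_card (monotone_filter_right _ fun _ _ he => Or.inr he)))
      have h3 : (c' : ℝ) ≤ #W' + #((G.edges X).filter fun e => e.1 ∈ W' ∨ e.2 ∈ W') :=
        mod_cast h2
      push_cast
      linarith
    · by_contra! hcon
      obtain ⟨h1, h2, h3⟩ := hcon
      refine h3 fun Q hQ hQd hdis => ?_
      have hQ' := hQ.of_sdiff hdis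
      obtain ⟨q, hq⟩ := hfind h1.not_ge hf hQ' hQd (h2 Q hQ' hQd)
      obtain ⟨hq, hqT⟩ := mem_inter.mp hq
      exact (mem_sdiff.mp (hQ.subset hq)).2 (ha.subset hqT)
  | @fallback _ c c' h hf hc =>
    refine ⟨hc.subset, hc.closed hX, .inl ⟨?_, hc.clean d, ?_⟩⟩
    · have h1 := hfw h hf
      have h2 : (c' : ℝ) ≤ 6 * G.numEdges := mod_cast hc.work_le
      push_cast
      linarith
    -- A nonempty result contains a trap. In a clean graph with a small source, a trap of at most
    -- `d` states would have made `Tr` nonempty.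
    · by_contra! hcon
      obtain ⟨h1, h2, h3, h4⟩ := hcon
      obtain ⟨Q, hQ⟩ := hc.exists_trap hX h1
      have hQd := card_le_card (hc.trap_subset hQ)
      obtain ⟨q, hq⟩ := hfind h2.not_ge hf hQ (by omega) (h3 Q hQ (by omega))
      simp at hq

/-- The number of edges that enter the states removed before the last iteration. -/
def passedEdges (G : GameGraph V) (c : Config V) : ℕ :=
  #((G.edges univ).filter fun e => e.2 ∉ c.states ∧ e.2 ∉ c.last)

/-- The bound on the work: `θ` bounds the work of the exploration, `ρ` is charged to each edge into
a removed set and `μ` to each removed state. -/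
def workBound (G : GameGraph V) (θ ρ μ : ℝ) (c : Config V) : ℝ :=
  Fintype.card V + 7 * G.numEdges + c.iter * (11 * θ + 1) + G.passedEdges c * (1 + ρ) +
    (2 + μ) * (Fintype.card V - #c.states) + 2 * (G.numEdges - #(G.edges c.states))

/-- The invariant of the loop. -/
structure Good (G : GameGraph V) (B : Finset V) (d : ℕ) (θ ρ μ : ℝ) (c : Config V) : Prop where
  closed : G.Closed c.states
  disjoint : Disjoint c.states c.last
  iter_le : c.iter + #c.states ≤ Fintype.card V
  work_le : G.Clean B d c.states c.last ∧ (c.work : ℝ) ≤ G.workBound θ ρ μ c ∨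
    (c.work : ℝ) + 6 * G.numEdges ≤ G.workBound θ ρ μ c

/-- Nothing has been removed yet, so small traps may exist without meeting the empty source. The
start therefore carries the credit, which is why `workBound` has 7m rather than m. -/
theorem good_start (G : GameGraph V) (B : Finset V) (d : ℕ) (θ ρ μ : ℝ) :
    G.Good B d θ ρ μ G.start where
  closed s _ := by simpa [start] using G.succ_nonempty s
  disjoint := disjoint_empty_right _
  iter_le := by simp [start]
  work_le := .inr <| by
    simp only [workBound, passedEdges, start, card_edges_univ]
    simp
    linarith

theorem card_edges_sdiff (G : GameGraph V) (X W' : Finset V) :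
    #(G.edges (X \ W')) + #((G.edges X).filter fun e => e.1 ∈ W' ∨ e.2 ∈ W') = #(G.edges X) := by
  rw [add_comm, ← card_filter_add_card_filter_not (s := G.edges X) fun e => e.1 ∈ W' ∨ e.2 ∈ W']
  congr 2
  ext e
  simp only [mem_edges, mem_sdiff, mem_filter]
  tauto

/-- One pass through the loop, in terms of the work bound. -/
theorem workBound_pass {θ ρ μ : ℝ} {c : Config V} {work : ℕ} {out : Finset V}
    (hd : Disjoint c.states c.last) (hW : W' ⊆ c.states) :
    G.workBound θ ρ μ ⟨c.iter + 1, c.states \ W', W', out, work⟩ =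
      G.workBound θ ρ μ c + 11 * θ + 1 +
        #((G.edges univ).filter fun e => e.2 ∈ c.last) * (1 + ρ) + (2 + μ) * #W' +
        2 * #((G.edges c.states).filter fun e => e.1 ∈ W' ∨ e.2 ∈ W') := by
  have h1 : (#(c.states \ W') : ℝ) + #W' = #c.states := mod_cast card_sdiff_add_card_eq_card hW
  have h2 : (#(G.edges (c.states \ W')) : ℝ) +
      #((G.edges c.states).filter fun e => e.1 ∈ W' ∨ e.2 ∈ W') = #(G.edges c.states) :=
    mod_cast G.card_edges_sdiff c.states W'
  -- Edges into `c.last` are charged one pass late, when its source is computed and tested.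
  have h3 : G.passedEdges ⟨c.iter + 1, c.states \ W', W', out, work⟩ =
      G.passedEdges c + #((G.edges univ).filter fun e => e.2 ∈ c.last) := by
    unfold passedEdges
    rw [← card_union_of_disjoint]
    · congr 1
      ext e
      have a : e.2 ∈ c.states → e.2 ∉ c.last := fun h => disjoint_left.mp hd h
      have b := @hW e.2
      simp only [mem_filter, mem_union, mem_sdiff]
      tauto
    · rw [disjoint_left]
      intro e he he'
      exact (mem_filter.mp he).2.2 (mem_filter.mp he').2
  simp only [workBound, h3]
  rw [← h1, ← h2]
  push_cast
  ring

/-- Only a pass that removes nothing may overdraw the bound, by one classical call; the loop then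
halts, so this happens once. -/
theorem Good.pass {c c' : Config V} {ρ μ : ℝ} (hg : G.Good B d (G.threshold β) ρ μ c)
    (h : G.Pass β B c c') (hτ : τ ≤ G.threshold β)
    (hθ : 0 ≤ G.threshold β) (hΔ2 : 2 ≤ Δ) (hΔ : G.maxOutdeg ≤ Δ)
    (hK : ∀ s : ℕ, (s : ℝ) < τ → 1 ≤ d → s * Δ ^ (d + 1) < ⌊2 * G.threshold β⌋₊)
    (hρ : 0 ≤ ρ) (hρτ : 12 * G.numEdges ≤ ρ * τ) (hμ : 0 ≤ μ)
    (hμd : 6 * G.numEdges ≤ μ * (d + 1)) :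
    (c'.last ≠ ∅ ∧ G.Good B d (G.threshold β) ρ μ c') ∨
      (c'.last = ∅ ∧ c'.iter + #c'.states ≤ Fintype.card V + 1 ∧
        (c'.work : ℝ) ≤ G.workBound (G.threshold β) ρ μ c' + 6 * G.numEdges) := by
  obtain ⟨-, W', w, hit, rfl⟩ := h
  obtain ⟨hW, hcl, hcase⟩ := hit.cost hg.closed hτ hθ hΔ2 hΔ hK
  have hb := G.workBound_pass (θ := G.threshold β) (ρ := ρ) (μ := μ) (out := c.out ∪ W')
    (work := c.work + w + #W' + #((G.edges c.states).filter fun e => e.1 ∈ W' ∨ e.2 ∈ W'))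
    hg.disjoint hW
  have hsw : (G.sourceWork c.last : ℝ) = 1 + #((G.edges univ).filter fun e => e.2 ∈ c.last) := by
    simp [sourceWork]
  have hsrc : (#(G.source c.last) : ℝ) ≤ #((G.edges univ).filter fun e => e.2 ∈ c.last) :=
    mod_cast G.card_source_le c.last
  set I : ℝ := (#((G.edges univ).filter fun e => e.2 ∈ c.last) : ℝ)
  set e := #((G.edges c.states).filter fun e => e.1 ∈ W' ∨ e.2 ∈ W')
  have hI : 0 ≤ I := Nat.cast_nonneg _
  have hpay : τ ≤ #(G.source c.last) → 12 * (G.numEdges : ℝ) ≤ I * ρ := fun h => by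
    have := mul_le_mul_of_nonneg_left (h.trans hsrc) hρ
    linarith
  have hIρ : 0 ≤ I * ρ := mul_nonneg hI hρ
  have hμW : 0 ≤ μ * (#W' : ℝ) := by positivity
  have he0 : (0 : ℝ) ≤ e := Nat.cast_nonneg _
  have hW0 : (0 : ℝ) ≤ #W' := Nat.cast_nonneg _
  have hm : (0 : ℝ) ≤ G.numEdges := Nat.cast_nonneg _
  have hwork : (c.work : ℝ) ≤ G.workBound (G.threshold β) ρ μ c := by
    rcases hg.work_le with h | h
    · exact h.2
    · linarith
  have hdirty : ¬ G.Clean B d c.states c.last →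
      (c.work : ℝ) + 6 * G.numEdges ≤ G.workBound (G.threshold β) ρ μ c := fun h =>
    hg.work_le.resolve_left fun h' => h h'.1
  have hcard : #(c.states \ W') + #W' = #c.states := card_sdiff_add_card_eq_card hW
  have hit := hg.iter_le
  by_cases hWe : W' = ∅
  · refine .inr ⟨hWe, ?_, ?_⟩
    · change c.iter + 1 + #(c.states \ W') ≤ _
      omega
    · rw [hb]
      push_cast
      rcases hcase with ⟨h, -⟩ | ⟨-, h, -⟩
      · linarith
      · exact absurd hWe h.ne_empty
  · refine .inl ⟨hWe, hcl, sdiff_disjoint, ?_, ?_⟩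
    · change c.iter + 1 + #(c.states \ W') ≤ _
      have := (nonempty_iff_ne_empty.mpr hWe).card_pos
      omega
    · rw [hb]
      push_cast
      -- A classical call is paid for by a large source, by the stored credit, or by `d + 1` removed
      -- states. After an exploration, a large source supplies the credit, and an unclean graph
      -- passes it on.
      rcases hcase with ⟨h, hcln, h1 | h1 | h1 | h1⟩ | ⟨h, -, h1 | h1 | h1⟩
      · exact absurd h1 hWe
      · have := hpay h1
        exact .inl ⟨hcln, by linarith⟩
      · have := hdirty h1
        exact .inl ⟨hcln, by linarith⟩
      · have h2 : (d : ℝ) + 1 ≤ #W' := mod_cast h1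
        have := mul_le_mul_of_nonneg_left h2 hμ
        exact .inl ⟨hcln, by linarith⟩
      · have := hpay h1
        exact .inr (by linarith)
      · have := hdirty h1
        exact .inr (by linarith)
      · rcases hg.work_le with h2 | h2
        · exact .inl ⟨h1, by linarith⟩
        · exact .inr (by linarith)

/-- The bound on the work in all reachable configurations. -/
theorem Reachable.work_le {c : Config V} {ρ μ : ℝ} (h : G.Reachable β B c)
    (hτ : τ ≤ G.threshold β)
    (hθ : 0 ≤ G.threshold β) (hΔ2 : 2 ≤ Δ) (hΔ : G.maxOutdeg ≤ Δ)
    (hK : ∀ s : ℕ, (s : ℝ) < τ → 1 ≤ d → s * Δ ^ (d + 1) < ⌊2 * G.threshold β⌋₊)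
    (hρ : 0 ≤ ρ) (hρτ : 12 * G.numEdges ≤ ρ * τ) (hμ : 0 ≤ μ)
    (hμd : 6 * G.numEdges ≤ μ * (d + 1)) :
    (c.work : ℝ) ≤ Fintype.card V + 13 * G.numEdges +
      (Fintype.card V + 1) * (11 * G.threshold β + 1) + G.numEdges * (1 + ρ) +
      (2 + μ) * Fintype.card V + 2 * G.numEdges := by
  have key : (¬ c.Halted ∧ G.Good B d (G.threshold β) ρ μ c) ∨
      (c.Halted ∧ c.iter + #c.states ≤ Fintype.card V + 1 ∧
        (c.work : ℝ) ≤ G.workBound (G.threshold β) ρ μ c + 6 * G.numEdges) := by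
    induction h with
    | refl => exact .inl ⟨by simp [Config.Halted, start], good_start ..⟩
    | @tail c c' _ hp ih =>
      rcases ih with ⟨-, hg⟩ | ⟨hh, -⟩
      · have hpos : 0 < c'.iter := by
          obtain ⟨-, W', w, -, rfl⟩ := hp
          exact Nat.succ_pos _
        refine (hg.pass hp hτ hθ hΔ2 hΔ hK hρ hρτ hμ hμd).imp ?_ ?_
        · exact fun h => ⟨fun hh => h.1 hh.2, h.2⟩
        · exact fun h => ⟨⟨hpos, h.1⟩, h.2⟩
      · exact absurd hh hp.1
  have hm : (0 : ℝ) ≤ G.numEdges := Nat.cast_nonneg _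
  have key' : c.iter + #c.states ≤ Fintype.card V + 1 ∧
      (c.work : ℝ) ≤ G.workBound (G.threshold β) ρ μ c + 6 * G.numEdges := by
    rcases key with ⟨-, hg⟩ | ⟨-, h⟩
    · refine ⟨hg.iter_le.trans (Nat.le_succ _), ?_⟩
      rcases hg.work_le with h | h
      · linarith [h.2]
      · linarith
    · exact h
  have h1 : (c.iter : ℝ) ≤ Fintype.card V + 1 := by
    have := key'.1
    exact_mod_cast (by omega : c.iter ≤ Fintype.card V + 1)
  have h2 : (G.passedEdges c : ℝ) ≤ G.numEdges := by
    exact_mod_cast (card_filter_le _ _).trans G.card_edges_univ.le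
  have h3 := mul_le_mul_of_nonneg_right h1 (by positivity : 0 ≤ 11 * G.threshold β + 1)
  have h4 := mul_le_mul_of_nonneg_right h2 (by positivity : 0 ≤ 1 + ρ)
  have h5 : 0 ≤ (2 + μ) * (#c.states : ℝ) := by positivity
  have h6 : (0 : ℝ) ≤ #(G.edges c.states) := Nat.cast_nonneg _
  have h7 := key'.2
  unfold workBound at h7
  linarith

/-- The algorithm never gets stuck. -/
theorem exists_pass (G : GameGraph V) (β : ℝ) (B : Finset V) {c : Config V} (h : ¬ c.Halted) :
    ∃ c', G.Pass β B c c' := by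
  suffices hs : ∃ W' w, G.Iteration β B c.states c.last W' w by
    obtain ⟨W', w, hit⟩ := hs
    exact ⟨_, h, W', w, hit, rfl⟩
  obtain ⟨W₁, c₁, h1⟩ := AvoidSetClassical.exists G B c.states
  obtain ⟨Tr, c₂, h2⟩ := Forward.exists G β B c.states c.last
  obtain ⟨W₃, c₃, h3⟩ := AttrRun.exists G.player1ᶜ (G.edges c.states) Tr
  by_cases ht : G.threshold β ≤ #(G.source c.last)
  · exact ⟨_, _, .large ht h1⟩
  · rcases Tr.eq_empty_or_nonempty with rfl | hTr
    · exact ⟨_, _, .fallback (not_le.mp ht) h2 h1⟩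
    · exact ⟨_, _, .found (not_le.mp ht) h2 hTr h3⟩

end Bounds

end GameGraph

/-! ### Estimates for the parameters and the final bound -/

theorem exists_logb_pow_four_le (β : ℝ) :
    ∃ N : ℕ, ∀ n : ℕ, N ≤ n → Real.logb β n ^ 4 ≤ n := by
  have h1 : (fun x : ℝ => Real.logb β x ^ 4) =o[Filter.atTop] (id : ℝ → ℝ) := by
    have := (Real.isLittleO_pow_log_id_atTop (n := 4)).const_mul_left ((Real.log β)⁻¹ ^ 4)
    refine this.congr_left fun x => ?_
    rw [← mul_pow, Real.logb, div_eq_inv_mul]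
  have h2 := (h1.bound one_pos).natCast_atTop
  obtain ⟨N, hN⟩ := Filter.eventually_atTop.mp h2
  refine ⟨N, fun n hn => ?_⟩
  have := hN n hn
  simp only [id, one_mul, Real.norm_eq_abs, Nat.abs_cast] at this
  exact (le_abs_self _).trans this

/-- Since log x = 2 log √x ≤ 2√x. This makes both m√n and m log n of order nm / log n. -/
theorem log_sq_le {x : ℝ} (hx : 1 ≤ x) : Real.log x ^ 2 ≤ 4 * x := by
  have h0 : 0 ≤ x := by linarith
  have h1 : Real.log (√x) ≤ √x := (Real.log_le_sub_one_of_pos (by positivity)).trans (by linarith)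
  have h2 : Real.log (√x) = Real.log x / 2 := Real.log_sqrt h0
  have h3 := Real.log_nonneg hx
  nlinarith [Real.sq_sqrt h0, Real.sqrt_nonneg x]

/-- A search for `2 m / log n` steps from fewer than `m / (√n + log n)` states passes depth `d`. -/
theorem exploration_suffices {β : ℝ} (hβ : 1 < β) {N n m Δ d s : ℕ}
    (hN : ∀ n : ℕ, N ≤ n → Real.logb β n ^ 4 ≤ n) (hn : 2 ≤ n) (hnm : n ≤ m) (hΔ : 2 ≤ Δ)
    (hd : 1 ≤ d) (hpow : Δ ^ (max 8 N * d) ≤ n)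
    (hs : (s : ℝ) < m / (√n + Real.logb β n)) :
    s * Δ ^ (d + 1) < ⌊2 * (m / Real.logb β n)⌋₊ := by
  set L := Real.logb β n
  have hn0 : (0 : ℝ) < n := by positivity
  have hn2 : (2 : ℝ) ≤ n := mod_cast hn
  have hL : 0 < L := Real.logb_pos hβ (by linarith)
  have hm : (n : ℝ) ≤ m := mod_cast hnm
  have hNn : N ≤ n :=
    calc N ≤ max 8 N * d := (le_max_right 8 N).trans (Nat.le_mul_of_pos_right _ hd)
      _ ≤ 2 ^ (max 8 N * d) := Nat.lt_two_pow_self.le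
      _ ≤ Δ ^ (max 8 N * d) := Nat.pow_le_pow_left hΔ _
      _ ≤ n := hpow
  have hL4 : L ^ 4 ≤ n := hN n hNn
  have hy4 : ((Δ : ℝ) ^ (d + 1)) ^ 4 ≤ n := by
    -- For `d ≥ 1`, 4(d + 1) ≤ 8d. So Δ^(d+1) and log n are both at most n^(1/4), and their product
    -- is at most √n.
    have h1 : (Δ ^ (d + 1)) ^ 4 ≤ Δ ^ (max 8 N * d) := by
      rw [← pow_mul]
      refine Nat.pow_le_pow_right (by omega) ?_
      have := Nat.mul_le_mul_right d (le_max_left 8 N)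
      omega
    exact_mod_cast h1.trans hpow
  set y : ℝ := (Δ : ℝ) ^ (d + 1)
  have hy : 0 < y := by positivity
  have hyL : y * L ≤ √n := by
    refine Real.le_sqrt_of_sq_le ?_
    refine le_of_sq_le_sq ?_ hn0.le
    calc ((y * L) ^ 2) ^ 2 = y ^ 4 * L ^ 4 := by ring
      _ ≤ (n : ℝ) * n := mul_le_mul hy4 hL4 (by positivity) hn0.le
      _ = (n : ℝ) ^ 2 := by ring
  have hLn : L ≤ n := by
    by_contra! h
    have h1 : (1 : ℝ) ≤ L := by linarith
    have := le_self_pow₀ h1 (by norm_num : 4 ≠ 0)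
    linarith
  have hθ1 : 1 ≤ (m : ℝ) / L := (one_le_div hL).mpr (hLn.trans hm)
  have hlt : (s : ℝ) * y < m / L := by
    rw [lt_div_iff₀ hL, mul_assoc]
    have hpos : 0 < √(n : ℝ) + L := by positivity
    rw [lt_div_iff₀ hpos] at hs
    have : (s : ℝ) * (y * L) ≤ s * (√n + L) :=
      mul_le_mul_of_nonneg_left (by linarith) (Nat.cast_nonneg s)
    linarith
  -- As m / L ≥ 1, rounding 2m / L down still leaves at least m / L; the factor 2 in the search
  -- length absorbs the rounding.
  have hfl := Nat.lt_floor_add_one (2 * ((m : ℝ) / L))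
  have : ((s * Δ ^ (d + 1) : ℕ) : ℝ) < ⌊2 * ((m : ℝ) / L)⌋₊ := by
    push_cast
    linarith
  exact_mod_cast this

/-- All terms of the work bound are of the order `n m log Δ / log n`. -/
theorem work_terms_le {β : ℝ} (hβ : 1 < β) {a n m lΔ : ℝ} (hn : 2 ≤ n) (hnm : n ≤ m)
    (hl : Real.log 2 ≤ lΔ) :
    n + 13 * m + (n + 1) * (11 * (m / Real.logb β n) + 1) +
      m * (1 + 12 * (√n + Real.logb β n)) + (2 + 6 * m * (a * (lΔ / Real.log n))) * n + 2 * m ≤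
    (100 + 100 * Real.log β + 100 / Real.log β + 6 * a) * (n * m * (lΔ / Real.log n)) := by
  have hb : 0 < Real.log β := Real.log_pos hβ
  have hln : 0 < Real.log n := Real.log_pos (by linarith)
  have hl2 : 1 / 2 ≤ lΔ := by linarith [Real.log_two_gt_d9]
  have hn0 : 0 < n := by linarith
  have hm0 : 0 < m := by linarith
  have hlogn : Real.log n ≤ n := (Real.log_le_sub_one_of_pos hn0).trans (by linarith)
  have hsq := log_sq_le (by linarith : 1 ≤ n)
  have hsqrt : √n * Real.log n ≤ 2 * n := by
    have h1 : Real.log n ≤ 2 * √n := by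
      refine le_of_sq_le_sq ?_ (by positivity)
      rw [mul_pow, Real.sq_sqrt hn0.le]
      linarith
    nlinarith [Real.sq_sqrt hn0.le, Real.sqrt_nonneg n]
  set Z := n * m / Real.log n with hZ
  have hZ0 : 0 < Z := by positivity
  have hmZ : m ≤ Z := by
    rw [hZ, le_div_iff₀ hln]
    nlinarith
  have e1 : n * m * (lΔ / Real.log n) = Z * lΔ := by rw [hZ]; ring
  have e2 : n * (m / Real.logb β n) = Z * Real.log β := by
    rw [hZ, Real.logb]
    field_simp
  have e3 : m * √n ≤ 2 * Z := by
    rw [hZ, mul_div_assoc', le_div_iff₀ hln]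
    nlinarith
  have e4 : m * Real.logb β n ≤ 4 / Real.log β * Z := by
    rw [hZ, Real.logb, mul_div_assoc', div_mul_div_comm, div_le_div_iff₀ hb (by positivity)]
    nlinarith [mul_le_mul_of_nonneg_left hsq (by positivity : 0 ≤ m * Real.log β)]
  have e5 : m / Real.logb β n ≤ Z * Real.log β := by
    rw [← e2]
    have : 0 ≤ m / Real.logb β n := div_nonneg hm0.le (Real.logb_pos hβ (by linarith)).le
    nlinarith
  have e6 : (6 * m * (a * (lΔ / Real.log n))) * n = 6 * a * (Z * lΔ) := by rw [hZ]; ring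
  rw [e1]
  have hb' : 0 < 1 / Real.log β := by positivity
  -- Terms without the factor log Δ are absorbed because log Δ ≥ log 2 ≥ 1/2.
  have t1 : Z ≤ 2 * (Z * lΔ) := by nlinarith
  have t2 : Z * Real.log β ≤ 2 * (Real.log β * (Z * lΔ)) := by nlinarith
  have t3 : 1 / Real.log β * Z ≤ 2 * (1 / Real.log β * (Z * lΔ)) := by nlinarith
  have e4' : 4 / Real.log β * Z = 4 * (1 / Real.log β * Z) := by ring
  have e7 : 100 / Real.log β * (Z * lΔ) = 100 * (1 / Real.log β * (Z * lΔ)) := by ring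
  have p1 : 0 < Z * lΔ := by positivity
  have p2 : 0 < Real.log β * (Z * lΔ) := by positivity
  have p3 : 0 < 1 / Real.log β * (Z * lΔ) := by positivity
  nlinarith

/-- Termination is contained in the work bound: each pass costs at least the unit in `sourceWork`,
so the number of passes is bounded. -/
theorem mainTheorem5 (β : ℝ) (hβ : 1 < β) :
    ∃ C : ℝ, 0 < C ∧
      ∀ (V : Type*) [Fintype V] [DecidableEq V] (G : GameGraph V) (B : Finset V),
        2 ≤ Fintype.card V →
        ∀ c : GameGraph.Config V, G.Reachable β B c →
          (c.work : ℝ) ≤ C * ((Fintype.card V : ℝ) * (G.numEdges : ℝ) *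
            (Real.log (max (G.maxOutdeg : ℝ) 2) / Real.log (Fintype.card V : ℝ))) ∧
          (c.Halted ∨ ∃ c', G.Pass β B c c') := by
  obtain ⟨N, hN⟩ := exists_logb_pow_four_le β
  have hb : 0 < Real.log β := Real.log_pos hβ
  refine ⟨100 + 100 * Real.log β + 100 / Real.log β + 6 * (max 8 N : ℕ), by positivity, ?_⟩
  intro V _ _ G B hn c hc
  refine ⟨?_, or_iff_not_imp_left.mpr fun h => G.exists_pass β B h⟩
  have hn2 : (2 : ℝ) ≤ Fintype.card V := mod_cast hn
  have hnm : (Fintype.card V : ℝ) ≤ G.numEdges := mod_cast G.card_le_numEdges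
  have hln : 0 < Real.log (Fintype.card V) := Real.log_pos (by linarith)
  have hL : 0 < Real.logb β (Fintype.card V) := Real.logb_pos hβ (by linarith)
  have hmax : max (G.maxOutdeg : ℝ) 2 = (max G.maxOutdeg 2 : ℕ) := by push_cast; rfl
  rw [hmax]
  set Δ := max G.maxOutdeg 2
  have hΔ2 : 2 ≤ Δ := le_max_right _ _
  have hlΔ : Real.log 2 ≤ Real.log Δ := Real.log_le_log two_pos (mod_cast hΔ2)
  have hlΔ0 : 0 < Real.log Δ := (Real.log_pos one_lt_two).trans_le hlΔ
  set a := max 8 N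
  have ha : (0 : ℝ) < a := mod_cast (by omega : 0 < a)
  set q := Real.log (Fintype.card V) / (a * Real.log Δ)
  have hq : 0 < q := by positivity
  have hpow : Δ ^ (a * ⌊q⌋₊) ≤ Fintype.card V := by
    have h1 : (⌊q⌋₊ : ℝ) * (a * Real.log Δ) ≤ Real.log (Fintype.card V) :=
      (le_div_iff₀ (by positivity)).mp (Nat.floor_le hq.le)
    have h2 : Real.log ((Δ : ℝ) ^ (a * ⌊q⌋₊)) ≤ Real.log (Fintype.card V) := by
      rw [Real.log_pow]
      push_cast
      linarith
    have h3 := (Real.log_le_log_iff (by positivity) (by linarith)).mp h2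
    exact_mod_cast h3
  -- Here ρτ = 12m, and μ = 6m / q, so that μ(d + 1) ≥ 6m because ⌊q⌋ + 1 ≥ q. In τ, the summand log
  -- n gives τ ≤ m / log n, and √n leaves room for the factor Δ^(d+1).
  refine (hc.work_le (d := ⌊q⌋₊) (Δ := Δ) (ρ := 12 * (√(Fintype.card V) +
    Real.logb β (Fintype.card V)))
    (τ := G.numEdges / (√(Fintype.card V) + Real.logb β (Fintype.card V)))
    (μ := 6 * G.numEdges * (a * (Real.log Δ / Real.log (Fintype.card V))))
    ?_ ?_ hΔ2 (le_max_left _ _) ?_ ?_ ?_ ?_ ?_).trans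
    (work_terms_le hβ hn2 hnm hlΔ)
  · exact div_le_div_of_nonneg_left (Nat.cast_nonneg _) hL 
      (le_add_of_nonneg_left (Real.sqrt_nonneg _))
  · exact div_nonneg (Nat.cast_nonneg _) hL.le
  · intro s hs hd
    exact exploration_suffices hβ hN hn G.card_le_numEdges hΔ2 hd hpow hs
  · positivity
  · rw [mul_assoc, mul_div_cancel₀ _ (by positivity)]
  · positivity
  · have h1 : 1 ≤ a * (Real.log Δ / Real.log (Fintype.card V)) * (⌊q⌋₊ + 1) := by
      have h2 := (Nat.lt_floor_add_one q).le
      have h3 : a * (Real.log Δ / Real.log (Fintype.card V)) * q = 1 := by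
        simp only [q]
        field_simp
      refine h3.ge.trans ?_
      exact mul_le_mul_of_nonneg_left h2 (by positivity)
    have := mul_le_mul_of_nonneg_left h1 (by positivity : 0 ≤ 6 * (G.numEdges : ℝ))
    linarith
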